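/- Let $p$ be a prime, let $n\ge 1$ be an integer not divisible by $p$, let $h\in\mathbb F_p$ be nonzero, and let $\tilde h$ be the integer with $1\le\tilde h\le p-1$ congruent to $h$ modulo $p$. Let $\overline{\mathbb F}_p$ be an algebraic closure of $\mathbb F_p$, and let $a=(a_1,\dots,a_n)\in\overline{\mathbb F}_p^{\,n}$ be a point with pairwise distinct coordinates. For $i\ne j$ let $\Omega_{ij}$ be the $n\times n$ matrix whose $(i,i)$ and $(j,j)$ entries are $-1$, whose $(i,j)$ and $(j,i)$ entries are $1$, and whose other entries are $0$. The KZ connection on the trivial bundle $\mathcal V$ with fibre the space $V$ of $n$-vectors with zero sum of coordinates is $$\nabla_i=\frac{\partial}{\partial z_i}+h\sum_{j\ne i}\frac{\Omega_{ij}}{z_i-z_j},\qquad i=1,\dots,n.$$ A formal flat section of $\mathcal V$ at $a$ is a vector $I=(I_1,\dots,I_n)^{\intercal}$ with entries in $\overline{\mathbb F}_p[[z_1-a_1,\dots,z_n-a_n]]$ such that $I_1+\dots+I_n=0$ and $\nabla_i I=0$ for $i=1,\dots,n$, where the $1/(z_i-z_j)$ are expanded at $a$. The formal flat sections at $a$ form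 a module over the algebra $\overline{\mathbb F}_p[[(z_1-a_1)^p,\dots,(z_n-a_n)^p]]$. Let $P(x,z)=\prod_{s=1}^n(x-z_s)$ and define vectors $Q^{(k)}(z,h)$ of polynomials in $z=(z_1,\dots,z_n)$ with coefficients in $\mathbb F_p$ by $$P(x,z)^{\tilde h}\Big(\frac1{x-z_1},\dots,\frac1{x-z_n}\Big)^{\intercal}=\sum_k Q^{(k)}(z,h)\,x^k .$$ Set $d=\big[\frac{n\tilde h}{p}\big]$, the integer part of $n\tilde h/p$, and assume $d>0$. Then the module of formal flat sections of $\mathcal V$ at $a$ is a free module of rank $d$ over $\overline{\mathbb F}_p[[(z_1-a_1)^p,\dots,(z_n-a_n)^p]]$, and the $p$-hypergeometric solutions $Q^{(\ell p-1)}(z,h)$, $\ell=1,\dots,d$, expanded at $a$, form a basis of this module. -/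

import Mathlib

noncomputable section

namespace KZ

/-- The `n × n` matrix `Ω_{ij}` (for `i ≠ j`): its `(i,i)` and `(j,j)` entries are `-1`, its
`(i,j)` and `(j,i)` entries are `1`, and all its other entries vanish. -/
def Omega (R : Type*) [CommRing R] {n : ℕ} (i j : Fin n) : Matrix (Fin n) (Fin n) R :=
  Matrix.single i j 1 + Matrix.single j i 1 - Matrix.single i i 1 - Matrix.single j j 1

section Formal

variable {K : Type*} [Field K] {n : ℕ}

/-- The ring `K[[z_1 - a_1, …, z_n - a_n]]` is `MvPowerSeries (Fin n) K`, whose `i`-th variable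
stands for `z_i - a_i`. This is the coordinate function `z_i` as an element of that ring. -/
def coord (a : Fin n → K) (i : Fin n) : MvPowerSeries (Fin n) K :=
  MvPowerSeries.C (a i) + MvPowerSeries.X i

/-- The Gaudin Hamiltonian `H_i(z) = ∑_{j ≠ i} Ω_{ij} / (z_i - z_j)`, expanded at the point `a`.
When the `a_i` are pairwise distinct, `z_i - z_j` has the nonzero constant term `a_i - a_j` and
`⁻¹` is its inverse. -/
def gaudin (a : Fin n → K) (i : Fin n) : Matrix (Fin n) (Fin n) (MvPowerSeries (Fin n) K) :=
  ∑ j ∈ Finset.univ.erase i, (coord a i - coord a j)⁻¹ • Omega (MvPowerSeries (Fin n) K) i j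

/-- The component `∇_i = ∂/∂z_i + h H_i(z)` of the KZ connection on formal sections at `a`. -/
def nabla (a : Fin n → K) (h : K) (i : Fin n) (I : Fin n → MvPowerSeries (Fin n) K) :
    Fin n → MvPowerSeries (Fin n) K :=
  (fun j => MvPowerSeries.pderiv K i (I j)) + h • (gaudin a i).mulVec I

variable (K n) in
/-- The algebra `K[[(z_1 - a_1)^p, …, (z_n - a_n)^p]]`, as the subalgebra of all
`f((z_1 - a_1)^p, …, (z_n - a_n)^p)` with `f` a power series. -/
def pthPowerSeries (p : ℕ) [hp : Fact p.Prime] : Subalgebra K (MvPowerSeries (Fin n) K) :=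
  (MvPowerSeries.expand p hp.out.ne_zero : MvPowerSeries (Fin n) K →ₐ[K] _).range

theorem pderiv_eq_zero_of_mem (p : ℕ) [hp : Fact p.Prime] [CharP K p] (i : Fin n)
    {c : MvPowerSeries (Fin n) K} (hc : c ∈ pthPowerSeries K n p) :
    MvPowerSeries.pderiv K i c = 0 := by
  obtain ⟨f, rfl⟩ := hc
  ext m
  rw [MvPowerSeries.coeff_pderiv]
  by_cases hd : p ∣ m i + 1
  · have h0 : ((m i : K) + 1) = 0 := by exact_mod_cast (CharP.cast_eq_zero_iff K p _).2 hd
    simp [h0]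
  · have h0 := MvPowerSeries.coeff_expand_of_not_dvd p hp.out.ne_zero f
      (m := m + Finsupp.single i 1) (i := i) (by simpa using hd)
    simp only [AlgHom.toRingHom_eq_coe, RingHom.coe_coe]
    rw [h0]
    simp

/-- The formal flat sections at `a` of the bundle `V` of `n`-vectors with zero sum of coordinates,
with the KZ connection, as a module over `K[[(z_1 - a_1)^p, …, (z_n - a_n)^p]]`: the vectors
`I ∈ K[[z_1 - a_1, …, z_n - a_n]]^n` with `I_1 + ⋯ + I_n = 0` and `∇_i I = 0` for all `i`. -/
def flatSections (p : ℕ) [Fact p.Prime] [CharP K p] (a : Fin n → K) (h : K) :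
    Submodule (pthPowerSeries K n p) (Fin n → MvPowerSeries (Fin n) K) where
  carrier := {I | ∑ j, I j = 0 ∧ ∀ i, nabla a h i I = 0}
  zero_mem' := by
    refine ⟨by simp, fun i => ?_⟩
    ext j : 1
    simp [nabla]
  add_mem' := by
    rintro I J ⟨hI, hI'⟩ ⟨hJ, hJ'⟩
    refine ⟨by simp [Finset.sum_add_distrib, hI, hJ], fun i => ?_⟩
    have key : nabla a h i (I + J) = nabla a h i I + nabla a h i J := by
      ext j : 1
      simp only [nabla, Pi.add_apply, Pi.smul_apply, map_add, Matrix.mulVec_add, smul_add]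
      abel
    rw [key, hI' i, hJ' i, add_zero]
  smul_mem' := by
    rintro ⟨c, hc⟩ I ⟨hI, hI'⟩
    refine ⟨?_, fun i => ?_⟩
    · simp only [Pi.smul_apply, Subalgebra.smul_def, smul_eq_mul]
      rw [← Finset.mul_sum, hI, mul_zero]
    · have key : nabla a h i ((⟨c, hc⟩ : pthPowerSeries K n p) • I) = c • nabla a h i I := by
        have hcI : ((⟨c, hc⟩ : pthPowerSeries K n p) • I) = c • I := rfl
        rw [hcI]
        ext j : 1
        simp only [nabla, Pi.add_apply, Pi.smul_apply, Matrix.mulVec_smul, smul_eq_mul,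
          Derivation.leibniz, pderiv_eq_zero_of_mem p i hc, mul_zero, add_zero, mul_add,
          mul_smul_comm]
      rw [key, hI' i, smul_zero]

end Formal

section Hypergeometric

variable {p n : ℕ}

/-- The polynomial `P(x,z) = ∏_s (x - z_s)`, as a polynomial in `x` over `𝔽_p[z_1, …, z_n]`. -/
def masterP (p n : ℕ) : Polynomial (MvPolynomial (Fin n) (ZMod p)) :=
  ∏ s, (Polynomial.X - Polynomial.C (MvPolynomial.X s))

/-- `Q_j^{(k)}(z,h)`: the coefficient of `x^k` in the polynomial `P(x,z)^{h̃} / (x - z_j)`, where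
`h̃ = h.val` is the representative of `h` in `{0, …, p-1}`. For `h ≠ 0` the division by the monic
polynomial `x - z_j` is exact. -/
def hyperQ (h : ZMod p) (k : ℕ) (j : Fin n) : MvPolynomial (Fin n) (ZMod p) :=
  ((masterP p n ^ h.val) /ₘ (Polynomial.X - Polynomial.C (MvPolynomial.X j))).coeff k

/-- The vector of polynomials `Q^{(k)}(z,h)`, expanded in powers of `z_i - a_i` at the point `a`. -/
def hyperQFormal {K : Type*} [Field K] [Algebra (ZMod p) K] (a : Fin n → K) (h : ZMod p) (k : ℕ) :
    Fin n → MvPowerSeries (Fin n) K :=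
  fun j => MvPolynomial.aeval (coord a) (hyperQ h k j)

end Hypergeometric

end KZ

end

open Polynomial
open scoped Matrix

noncomputable section

/-! Write e for the representative of h and put `cofactor z e j` = P^e/(x - z_j). Flatness in
direction i amounts to (z_i - z_j) ∂_i I_j = e (I_j - I_i) for j ≠ i; component i follows from the
zero sum (`mem_flatSections_iff`). Every x-coefficient of the cofactor vector satisfies these
equations (`coeffDeriv_cofactor`). The sum of the cofactors, multiplied by e, is dP^e/dx, so the
coefficients of x^(lp-1) also sum to zero.

These d solutions are linearly independent already at the point a (`cofactor_coeff_independent`): a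
relation would create a gap in the coefficients of some Q P^(e-1) with Q' = 0. The first-order
equation satisfied by that product then splits at the gap, and degrees leave no room for a nonzero
solution.

That nothing else is flat comes from a duality between e and p - e. Since ∂_i^p = 0, a flat section
I satisfies ∂_i^e I_i = 0 (`iterate_derivation_self_eq_zero`). Hence F(x) = ∑ I_j P^(p-e)/(x - z_j)
has vanishing Taylor coefficient of order p - 1 at every z_i (`sum_mul_coeff_cofactor_eq_zero`). The
coefficients of x^(lp-1) in F form a polynomial in x^p of x-degree below np that vanishes at all
z_i, so they are zero (`coeff_eq_zero_of_taylor_coeff`): I is orthogonal to the solutions for p - e.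

As p does not divide n, the number of solutions for e, the number for p - e and the zero-sum
condition add up to n. Linear algebra over the local ring of power series writes I as a combination
of the solutions for e (`exists_eq_vecMul_of_mulVec_eq_zero`). Differentiating the combination shows
that its coefficients are killed by every ∂_i, hence are power series in the (z_i - a_i)^p. -/

namespace KZ

/-! ### The polynomials P^e/(x - z_j) -/

section Cofactor

variable {A : Type*} [CommRing A] {ι : Type*} [Fintype ι] [DecidableEq ι]

/-- The polynomial `P(x,z)^e / (x - z_j)`, where `P(x,z) = ∏_s (x - z_s)` and `e ≥ 1`. -/
def cofactor (z : ι → A) (e : ℕ) (j : ι) : A[X] :=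
  (X - C (z j)) ^ (e - 1) * ∏ s ∈ Finset.univ.erase j, (X - C (z s)) ^ e

theorem sub_mul_cofactor (z : ι → A) {e : ℕ} (he : 1 ≤ e) (j : ι) :
    (X - C (z j)) * cofactor z e j = (∏ s, (X - C (z s))) ^ e := by
  rw [cofactor, ← mul_assoc, ← pow_succ', Nat.sub_add_cancel he, ← Finset.prod_pow,
    Finset.mul_prod_erase _ (fun s => (X - C (z s)) ^ e) (Finset.mem_univ j)]

theorem cofactor_eq_pow_mul (z : ι → A) {e : ℕ} (he : 1 ≤ e) (j : ι) :
    cofactor z e j =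
      (∏ s, (X - C (z s))) ^ (e - 1) * ∏ s ∈ Finset.univ.erase j, (X - C (z s)) := by
  obtain ⟨e, rfl⟩ := Nat.exists_eq_add_of_le' he
  rw [cofactor, ← Finset.mul_prod_erase _ (fun s => (X - C (z s))) (Finset.mem_univ j),
    Finset.prod_pow, Nat.add_sub_cancel, mul_pow, pow_succ, mul_assoc]

theorem divByMonic_eq_cofactor (z : ι → A) {e : ℕ} (he : 1 ≤ e) (j : ι) :
    (∏ s, (X - C (z s))) ^ e /ₘ (X - C (z j)) = cofactor z e j := by
  rw [← sub_mul_cofactor z he j, mul_divByMonic_cancel_left _ (monic_X_sub_C _)]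

theorem map_cofactor {B : Type*} [CommRing B] (f : A →+* B) (z : ι → A) (e : ℕ) (j : ι) :
    (cofactor z e j).map f = cofactor (fun s => f (z s)) e j := by
  simp [cofactor, Polynomial.map_mul, Polynomial.map_prod, Polynomial.map_pow]

theorem taylor_cofactor (u : A) (z : ι → A) (e : ℕ) (j : ι) :
    taylor u (cofactor z e j) = cofactor (fun s => z s - u) e j := by
  have hX : ∀ b : A, (X - C b).comp (X + C u) = X - C (b - u) := fun b => by
    simp only [sub_comp, X_comp, C_comp, C_sub]; ring
  simp only [cofactor, taylor_apply, mul_comp, pow_comp, prod_comp, hX]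

/-- An x-derivative has no term x^(lp-1) in characteristic p; this is the source of the zero-sum
condition on the solutions. -/
theorem sum_cofactor (z : ι → A) {e : ℕ} (he : 1 ≤ e) :
    C (e : A) * ∑ j, cofactor z e j = derivative ((∏ s, (X - C (z s))) ^ e) := by
  rw [derivative_pow, derivative_prod_finset, mul_assoc]
  simp [cofactor_eq_pow_mul z he, Finset.mul_sum]

theorem natDegree_cofactor_lt [Nontrivial A] (z : ι → A) {e : ℕ} (he : 1 ≤ e) (j : ι) :
    (cofactor z e j).natDegree < Fintype.card ι * e := by
  have h := congrArg natDegree (sub_mul_cofactor z he j)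
  have hm : (cofactor z e j).Monic :=
    ((monic_X_sub_C _).pow _).mul (monic_prod_of_monic _ _ fun s _ => (monic_X_sub_C _).pow _)
  rw [(monic_X_sub_C (z j)).natDegree_mul hm, natDegree_X_sub_C,
    (monic_prod_X_sub_C z Finset.univ).natDegree_pow, natDegree_finsetProd_X_sub_C_eq_card,
    Finset.card_univ] at h
  rw [mul_comm]
  lia

theorem cofactor_eq_of_ne (z : ι → A) (e : ℕ) {i j : ι} (hij : i ≠ j) :
    cofactor z e j = (X - C (z j)) ^ (e - 1) * ((X - C (z i)) ^ e *
      ∏ s ∈ (Finset.univ.erase i).erase j, (X - C (z s)) ^ e) := by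
  rw [cofactor, Finset.erase_right_comm,
    Finset.mul_prod_erase _ (fun s => (X - C (z s)) ^ e) (by simp [hij])]

end Cofactor

/-! ### Derivations acting on coefficients, and the KZ equations -/

section CoeffDeriv

variable {S A : Type*} [CommRing S] [CommRing A] [Algebra S A]

/-- The derivation of `A[X]` that applies a given derivation of `A` to the coefficients. -/
def coeffDeriv (D : Derivation S A A) : Derivation S A[X] A[X] :=
  PolynomialModule.equivPolynomialSelf.compDer D.mapCoeffs

variable (D : Derivation S A A)

@[simp]
theorem coeff_coeffDeriv (f : A[X]) (k : ℕ) : (coeffDeriv D f).coeff k = D (f.coeff k) := rfl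

theorem coeffDeriv_X_sub_C (b : A) : coeffDeriv D (X - C b) = -C (D b) := by
  ext k
  rcases k with _ | _ | k <;> simp [coeff_X, coeff_C]

theorem derivation_prod_eq_zero {B : Type*} [CommRing B] [Algebra S B]
    (E : Derivation S B B) {ι : Type*} (s : Finset ι) (f : ι → B) (h : ∀ i ∈ s, E (f i) = 0) : E (∏ i ∈ s, f i) = 0 :=
  Finset.prod_induction f (fun x => E x = 0)
    (fun x y hx hy => by rw [E.leibniz, hx, hy, smul_zero, smul_zero, add_zero])
    E.map_one_eq_zero h

theorem derivation_pow_eq_zero {B : Type*} [CommRing B] [Algebra S B] (E : Derivation S B B) {f : B}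
    (h : E f = 0) (k : ℕ) : E (f ^ k) = 0 := by
  rw [E.leibniz_pow, h, smul_zero, smul_zero]

/-- Partial fractions: ∂_i (P^e/(x - z_j)) = -e P^e/((x - z_i)(x - z_j)). Taking coefficients in x
gives the KZ equations with denominators cleared. -/
theorem coeffDeriv_cofactor {ι : Type*} [Fintype ι] [DecidableEq ι] {z : ι → A} {i j : ι}
    (hij : i ≠ j) (hi : D (z i) = 1) (hz : ∀ s, s ≠ i → D (z s) = 0) {e : ℕ} (he : 1 ≤ e) :
    C (z i - z j) * coeffDeriv D (cofactor z e j) =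
      C (e : A) * (cofactor z e j - cofactor z e i) := by
  have hW : coeffDeriv D (∏ s ∈ (Finset.univ.erase i).erase j, (X - C (z s)) ^ e) = 0 := by
    refine derivation_prod_eq_zero _ _ _ fun s hs => derivation_pow_eq_zero _ ?_ _
    rw [coeffDeriv_X_sub_C, hz s (by simp at hs; exact hs.2), C_0, neg_zero]
  have hj : coeffDeriv D ((X - C (z j)) ^ (e - 1)) = 0 := by
    refine derivation_pow_eq_zero _ ?_ _
    rw [coeffDeriv_X_sub_C, hz j hij.symm, C_0, neg_zero]
  rw [cofactor_eq_of_ne z e hij, cofactor_eq_of_ne z e hij.symm, Finset.erase_right_comm (a := j)]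
  simp only [Derivation.leibniz, Derivation.leibniz_pow, hW, hj, coeffDeriv_X_sub_C, hi,
    smul_eq_mul, nsmul_eq_mul, C_1, C_sub, C_eq_natCast]
  obtain ⟨e, rfl⟩ := Nat.exists_eq_add_of_le' he
  simp only [Nat.add_sub_cancel]
  ring

/-- The coefficients of a polynomial on which `D` acts as `d/dx` are the divided iterated
derivatives of its constant coefficient. -/
theorem factorial_mul_coeff {f : A[X]} (hf : coeffDeriv D f = derivative f) (k : ℕ) :
    (k.factorial : A) * f.coeff k = D^[k] (f.coeff 0) := by
  induction k with
  | zero => simp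
  | succ k ih =>
    have h : D (f.coeff k) = f.coeff (k + 1) * (k + 1) := by
      rw [← coeff_coeffDeriv, hf, coeff_derivative]
    rw [Function.iterate_succ_apply', ← ih, Derivation.leibniz, Derivation.map_natCast, h,
      Nat.factorial_succ]
    push_cast
    simp only [smul_eq_mul, mul_zero, add_zero]
    ring

theorem coeffDeriv_eq_derivative_mul {f g : A[X]} (hf : coeffDeriv D f = derivative f)
    (hg : coeffDeriv D g = derivative g) : coeffDeriv D (f * g) = derivative (f * g) := by
  rw [Derivation.leibniz, hf, hg, derivative_mul, smul_eq_mul, smul_eq_mul]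
  ring

theorem coeffDeriv_eq_derivative_pow {f : A[X]} (hf : coeffDeriv D f = derivative f) (k : ℕ) :
    coeffDeriv D (f ^ k) = derivative (f ^ k) := by
  rw [Derivation.leibniz_pow, hf, derivative_pow, nsmul_eq_mul, smul_eq_mul, C_eq_natCast]
  ring

theorem coeffDeriv_eq_derivative_prod {ι : Type*} (s : Finset ι) (f : ι → A[X])
    (h : ∀ i ∈ s, coeffDeriv D (f i) = derivative (f i)) :
    coeffDeriv D (∏ i ∈ s, f i) = derivative (∏ i ∈ s, f i) :=
  Finset.prod_induction f (fun x => coeffDeriv D x = derivative x)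
    (fun _ _ => coeffDeriv_eq_derivative_mul D)
    (by rw [Derivation.map_one_eq_zero, derivative_one]) h

theorem coeffDeriv_X_sub_C_eq_derivative {b : A} (hb : D b = -1) :
    coeffDeriv D (X - C b) = derivative (X - C b) := by
  simp [coeffDeriv_X_sub_C, hb]

end CoeffDeriv

/-! ### Linear independence of the solutions at a point -/

section Independence

variable {K : Type*} [Field K]

/-- The equation says A'/A = m P'/P with P = (X - a) S. If A vanishes to order exactly k at a,
comparing residues gives k = m in K, which `hm` excludes for k < m. -/
theorem pow_dvd_of_wronskian {a : K} {S A : K[X]} (hS : S.eval a ≠ 0) {m : ℕ}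
    (hm : ∀ k < m, (k : K) ≠ m)
    (h : derivative A * ((X - C a) * S) = C (m : K) * A * derivative ((X - C a) * S)) :
    ∀ k ≤ m, (X - C a) ^ k ∣ A := by
  intro k
  induction k with
  | zero => simp
  | succ k ih =>
    intro hk
    obtain ⟨T, hT⟩ := ih (by lia)
    have key : (X - C a) ^ k * ((C (k : K) - C (m : K)) * (T * S) +
        (X - C a) * (derivative T * S - C (m : K) * T * derivative S)) = 0 := by
      rw [hT] at h
      simp only [derivative_mul, derivative_pow, derivative_sub, derivative_X, derivative_C,
        sub_zero, mul_one] at h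
      rcases k with _ | k
      · simp only [Nat.cast_zero, C_0, pow_zero] at h ⊢
        linear_combination h
      · rw [Nat.add_sub_cancel] at h
        linear_combination h
    have key2 := (mul_eq_zero.1 key).resolve_left (pow_ne_zero _ (X_sub_C_ne_zero a))
    have key3 := congrArg (eval a) key2
    simp only [eval_add, eval_mul, eval_sub, eval_C, eval_X, sub_self, zero_mul, add_zero,
      eval_zero] at key3
    have hTa : T.eval a = 0 := by
      rcases mul_eq_zero.1 key3 with h1 | h1
      · exact absurd (sub_eq_zero.1 h1) (hm k (by lia))
      · exact (mul_eq_zero.1 h1).resolve_right hS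
    obtain ⟨U, hU⟩ := dvd_iff_isRoot.2 hTa
    exact ⟨U, by rw [hT, hU]; ring⟩

variable {ι : Type*} [Fintype ι] [DecidableEq ι]

theorem eq_zero_of_wronskian {a : ι → K} (ha : Function.Injective a) {A : K[X]} {m : ℕ}
    (hm : ∀ k < m, (k : K) ≠ m)
    (h : derivative A * (∏ s, (X - C (a s))) =
      C (m : K) * A * derivative (∏ s, (X - C (a s))))
    (hdeg : A ≠ 0 → A.natDegree < Fintype.card ι * m) : A = 0 := by
  by_contra hA
  have hdvd : (∏ s, (X - C (a s)) ^ m) ∣ A := by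
    refine Fintype.prod_dvd_of_coprime ?_ fun s => ?_
    · intro s t hst
      exact (pairwise_coprime_X_sub_C ha hst).pow
    · rw [← Finset.mul_prod_erase _ _ (Finset.mem_univ s)] at h
      refine pow_dvd_of_wronskian ?_ hm h m le_rfl
      rw [eval_prod, Finset.prod_ne_zero_iff]
      intro t ht
      simpa [sub_eq_zero] using fun hst => (Finset.ne_of_mem_erase ht) (ha hst).symm
  have h1 := natDegree_le_of_dvd hdvd hA
  rw [Finset.prod_pow, (monic_prod_X_sub_C a Finset.univ).natDegree_pow,
    natDegree_finsetProd_X_sub_C_eq_card, Finset.card_univ, mul_comm] at h1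
  exact absurd (hdeg hA) (by lia)

theorem eq_sum_C_mul_prod_erase {a : ι → K} (ha : Function.Injective a) {g : K[X]}
    (hg : g.degree < Fintype.card ι) :
    ∃ r : ι → K, g = ∑ j, C (r j) * ∏ s ∈ Finset.univ.erase j, (X - C (a s)) := by
  refine ⟨fun j => g.eval (a j) * ∏ s ∈ Finset.univ.erase j, (a j - a s)⁻¹, ?_⟩
  conv_lhs => rw [Lagrange.eq_interpolate (s := Finset.univ) (v := a) ha.injOn hg]
  rw [Lagrange.interpolate_apply]
  refine Finset.sum_congr rfl fun j _ => ?_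
  simp only [Lagrange.basis, Lagrange.basisDivisor, Finset.prod_mul_distrib, C_mul, map_prod]
  ring

/-- By Lagrange interpolation the products omitting one factor span all polynomials of degree below
n, so a condition on the cofactors becomes one on all such multiples of P^(e-1). -/
theorem coeff_mul_eq_zero_of_cofactor {a : ι → K} (ha : Function.Injective a) {e N : ℕ}
    (he : 1 ≤ e) {Q : K[X]} (hQ : ∀ j, (Q * cofactor a e j).coeff N = 0) {g : K[X]}
    (hg : g.degree < Fintype.card ι) :
    (Q * (∏ s, (X - C (a s))) ^ (e - 1) * g).coeff N = 0 := by
  obtain ⟨r, rfl⟩ := eq_sum_C_mul_prod_erase ha hg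
  rw [Finset.mul_sum, finsetSum_coeff]
  refine Finset.sum_eq_zero fun j _ => ?_
  rw [mul_left_comm, coeff_C_mul, mul_assoc, ← cofactor_eq_pow_mul a he, hQ, mul_zero]

theorem eq_zero_of_coeff_mul_cofactor {a : ι → K} (ha : Function.Injective a) {e N : ℕ} (he : 1 ≤ e)
    (hm : ∀ k < e - 1, (k : K) ≠ (e - 1 : ℕ)) (hN : (N : K) = 0) (hNe : N ≤ Fintype.card ι * e)
    {Q : K[X]} (hQ' : derivative Q = 0) (hQd : Q.natDegree < N)
    (hQ : ∀ j, (Q * cofactor a e j).coeff (N - 1) = 0) : Q = 0 := by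
  set n := Fintype.card ι with hn
  set P := ∏ s, (X - C (a s)) with hP
  have hPm : P.Monic := monic_prod_X_sub_C a Finset.univ
  have hPd : P.natDegree = n := by
    rw [hP, natDegree_finsetProd_X_sub_C_eq_card, Finset.card_univ]
  set B := Q * P ^ (e - 1) with hB
  have hXm : (X ^ N : K[X]).Monic := monic_X_pow N
  set L := B %ₘ X ^ N
  set A := B /ₘ X ^ N
  have hBLA : L + X ^ N * A = B := modByMonic_add_div B (X ^ N)
  have hLd : L.degree < N := by
    simpa using degree_modByMonic_lt B hXm
  -- The gap: testing against the monomials x^(N-1-m) kills the coefficients of B in the n degrees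
  -- just below N.
  have hL0 : ∀ m, N ≤ m + n → L.coeff m = 0 := by
    intro m hmN
    rcases le_or_gt N m with h | h
    · exact coeff_eq_zero_of_degree_lt (hLd.trans_le (by exact_mod_cast h))
    · have h1 := coeff_mul_eq_zero_of_cofactor ha he hQ (g := X ^ (N - 1 - m))
        (by rw [degree_X_pow]; exact_mod_cast (by lia : N - 1 - m < Fintype.card ι))
      rw [← hP, ← hB, coeff_mul_X_pow', if_pos (by lia), show N - 1 - (N - 1 - m) = m by lia,
        ← hBLA, coeff_add, coeff_X_pow_mul', if_neg (by lia), add_zero] at h1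
      exact h1
  have hLn : L ≠ 0 → L.natDegree + n < N := by
    intro h
    by_contra! h'
    exact h (leadingCoeff_eq_zero.1 (hL0 _ h'))
  -- This operator kills P^(e-1), and also B because Q' = 0. It commutes with multiplication by X^N
  -- because N = 0 in K.
  let w : K[X] → K[X] := fun f => derivative f * P - C ((e - 1 : ℕ) : K) * f * derivative P
  have hwB : w B = 0 := by
    simp only [w, hB, derivative_mul, hQ', derivative_pow, zero_mul, zero_add]
    rcases e with _ | _ | e
    · simp at he
    · simp
    · simp only [Nat.add_sub_cancel]
      ring
  have hwLA : w L + X ^ N * w A = 0 := by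
    rw [← hwB, ← hBLA]
    simp only [w, derivative_add, derivative_mul, derivative_X_pow, hN, C_0, zero_mul, zero_add]
    ring
  -- `w` raises degrees by at most n - 1, so thanks to the gap `w L` cannot meet X^N `w A`, and both
  -- vanish.
  have hwLd : (w L).degree < (X ^ N : K[X]).degree := by
    rw [degree_X_pow]
    by_cases hL : L = 0
    · simp [w, hL]
    have h1 : L.degree + P.degree ≤ N := by
      rw [degree_eq_natDegree hL, degree_eq_natDegree hPm.ne_zero, hPd]
      exact_mod_cast (hLn hL).le
    refine (degree_sub_le _ _).trans_lt (max_lt ?_ ?_)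
    · rw [degree_mul]
      refine lt_of_lt_of_le ?_ h1
      exact WithBot.add_lt_add_right (degree_ne_bot.2 hPm.ne_zero) (degree_derivative_lt hL)
    · rw [mul_assoc, ← smul_eq_C_mul]
      refine (degree_smul_le _ _).trans_lt ?_
      rw [degree_mul]
      refine lt_of_lt_of_le ?_ h1
      exact WithBot.add_lt_add_left (degree_ne_bot.2 hL) (degree_derivative_lt hPm.ne_zero)
  have hu := div_modByMonic_unique (f := (0 : K[X])) (w A) (w L) hXm ⟨hwLA, hwLd⟩
  rw [zero_divByMonic, zero_modByMonic] at hu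
  have hA : A = 0 := by
    refine eq_zero_of_wronskian ha hm (sub_eq_zero.1 hu.1.symm) fun hA => ?_
    have h1 : (X ^ N * A).natDegree = N + A.natDegree := by
      rw [hXm.natDegree_mul' hA, natDegree_X_pow]
    have h2 : B.natDegree = N + A.natDegree := by
      rw [← hBLA, natDegree_add_eq_right_of_degree_lt, h1]
      rw [degree_eq_natDegree (mul_ne_zero hXm.ne_zero hA), h1]
      exact hLd.trans_le (by exact_mod_cast Nat.le_add_right _ _)
    have h3 : B.natDegree ≤ Q.natDegree + (e - 1) * n := by
      rw [hB, ← hPd, ← hPm.natDegree_pow]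
      exact natDegree_mul_le
    rw [← hn, mul_comm]
    lia
  have hL : L = 0 := by
    refine eq_zero_of_wronskian ha hm (sub_eq_zero.1 hu.2.symm) fun hL => ?_
    have h1 := hLn hL
    obtain ⟨e, rfl⟩ := Nat.exists_eq_add_of_le' he
    rw [Nat.add_sub_cancel, ← hn]
    rw [mul_add] at hNe
    lia
  rw [hA, hL, mul_zero, add_zero] at hBLA
  exact (mul_eq_zero.1 hBLA.symm).resolve_right (pow_ne_zero _ hPm.ne_zero)

theorem cofactor_coeff_independent {a : ι → K} (ha : Function.Injective a) (p : ℕ)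
    [Fact p.Prime] [CharP K p] {e d : ℕ} (he : 1 ≤ e) (hep : e < p)
    (hd : d * p ≤ Fintype.card ι * e) (c : ℕ → K)
    (h : ∀ j, ∑ l ∈ Finset.range d, c l * (cofactor a e j).coeff ((l + 1) * p - 1) = 0) :
    ∀ l < d, c l = 0 := by
  intro l hl
  have hp : 0 < p := (Fact.out : p.Prime).pos
  -- The exponents are reversed so that multiplication by Q moves every coefficient of index (l+1)p
  -- - 1 to the single index dp - 1.
  set Q : K[X] := ∑ l ∈ Finset.range d, C (c l) * X ^ ((d - 1 - l) * p) with hQ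
  have hQ0 : Q = 0 := by
    refine eq_zero_of_coeff_mul_cofactor ha (N := d * p) he ?_ (by simp) hd ?_ ?_ ?_
    · intro k hk hk'
      have := CharP.natCast_injOn_Iio K p (Set.mem_Iio.2 (by lia)) (Set.mem_Iio.2 (by lia)) hk'
      lia
    · simp [hQ, derivative_X_pow]
    · refine lt_of_le_of_lt (b := (d - 1) * p) ?_ ?_
      · refine natDegree_sum_le_of_forall_le _ _ fun i hi => ?_
        refine (natDegree_C_mul_X_pow_le _ _).trans ?_
        exact Nat.mul_le_mul_right _ (by lia)
      · exact Nat.mul_lt_mul_of_pos_right (by lia) hp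
    · intro j
      rw [← h j, hQ, Finset.sum_mul, finsetSum_coeff]
      refine Finset.sum_congr rfl fun i hi => ?_
      rw [Finset.mem_range] at hi
      have e1 : (d - 1 - i) * p + (i + 1) * p = d * p := by
        rw [← add_mul]; congr 1; lia
      have e2 : 0 < (i + 1) * p := by positivity
      rw [mul_assoc, coeff_C_mul, coeff_X_pow_mul', if_pos (by lia)]
      congr 2
      lia
  have h1 := congrArg (fun f => coeff f ((d - 1 - l) * p)) hQ0
  simp only [hQ, finsetSum_coeff, coeff_C_mul_X_pow, coeff_zero] at h1
  rwa [Finset.sum_eq_single l, if_pos rfl] at h1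
  · intro i hi hil
    rw [Finset.mem_range] at hi
    rw [if_neg]
    intro h2
    have := Nat.eq_of_mul_eq_mul_right hp h2
    lia
  · intro h2
    exact absurd (Finset.mem_range.2 hl) h2

end Independence

theorem isUnit_natCast_factorial (A : Type*) [CommRing A] (p : ℕ) [hp : Fact p.Prime] [CharP A p]
    {k : ℕ} (hk : k < p) : IsUnit (k.factorial : A) :=
  (CharP.isUnit_natCast_iff hp.out).2 fun h => hk.not_ge (hp.out.dvd_factorial.1 h)

/-! ### Consequences of D^p = 0 for a flat section -/

section Curvature

variable {S A : Type*} [CommRing S] [CommRing A] [Algebra S A] (D : Derivation S A A)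

theorem iterate_derivation_mul {b : A} (hb : D b = 1) (f : A) (k : ℕ) :
    D^[k] (b * f) = b * D^[k] f + k * D^[k - 1] f := by
  induction k with
  | zero => simp
  | succ k ih =>
    rw [Function.iterate_succ_apply', ih, map_add, Derivation.leibniz, Derivation.leibniz, hb,
      Derivation.map_natCast, Function.iterate_succ_apply', Nat.add_sub_cancel]
    rcases k with _ | k
    · simp
    · rw [Nat.add_sub_cancel, ← Function.iterate_succ_apply' D k f]
      push_cast
      simp only [smul_eq_mul]
      ring

theorem iterate_derivation_const_mul {c : A} (hc : D c = 0) (f : A) (k : ℕ) :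
    D^[k] (c * f) = c * D^[k] f := by
  induction k with
  | zero => simp
  | succ k ih =>
    rw [Function.iterate_succ_apply', ih, Derivation.leibniz, hc, Function.iterate_succ_apply',
      smul_zero, add_zero, smul_eq_mul]

theorem iterate_derivation_zero (k : ℕ) : D^[k] (0 : A) = 0 :=
  Function.iterate_fixed (map_zero D) k

theorem iterate_derivation_sum {ι : Type*} (s : Finset ι) (f : ι → A) (k : ℕ) :
    D^[k] (∑ j ∈ s, f j) = ∑ j ∈ s, D^[k] (f j) := by
  induction k with
  | zero => simp
  | succ k ih => simp only [Function.iterate_succ_apply', ih, map_sum]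

variable {ι : Type*} [DecidableEq ι]

/-- `∏_{s ∈ t} b_s^e / b_j`, for `j ∈ t` and `e ≥ 1`. -/
def prodDiv (t : Finset ι) (b : ι → A) (e : ℕ) (j : ι) : A :=
  b j ^ (e - 1) * ∏ s ∈ t.erase j, b s ^ e

theorem mul_prodDiv (t : Finset ι) (b : ι → A) {e : ℕ} (he : 1 ≤ e) {j : ι} (hj : j ∈ t) :
    b j * prodDiv t b e j = ∏ s ∈ t, b s ^ e := by
  rw [prodDiv, ← mul_assoc, ← pow_succ', Nat.sub_add_cancel he,
    Finset.mul_prod_erase t (fun s => b s ^ e) hj]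

theorem derivation_prod_pow (t : Finset ι) (b : ι → A) (hb : ∀ s ∈ t, D (b s) = 1) (e : ℕ) :
    D (∏ s ∈ t, b s ^ e) = e * ∑ j ∈ t, prodDiv t b e j := by
  induction t using Finset.induction_on with
  | empty => simp
  | insert a t ha ih =>
    rw [Finset.prod_insert ha, Derivation.leibniz, ih fun s hs => hb s (Finset.mem_insert_of_mem hs),
      Derivation.leibniz_pow, hb a (Finset.mem_insert_self a t), Finset.sum_insert ha]
    have h1 : prodDiv (insert a t) b e a = b a ^ (e - 1) * ∏ s ∈ t, b s ^ e := by
      rw [prodDiv, Finset.erase_insert ha]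
    have h2 : ∀ j ∈ t, prodDiv (insert a t) b e j = b a ^ e * prodDiv t b e j := fun j hj => by
      have hja : a ≠ j := fun h => ha (h ▸ hj)
      rw [prodDiv, prodDiv, Finset.erase_insert_of_ne hja,
        Finset.prod_insert (fun h => ha (Finset.mem_of_mem_erase h))]
      ring
    rw [h1, Finset.sum_congr rfl h2, ← Finset.mul_sum]
    simp only [smul_eq_mul, nsmul_eq_mul]
    ring

variable [Fintype ι] {z : ι → A} {i : ι}

/-- After the translation by z_i, D acts on each factor x - (z_s - z_i) with s ≠ i as d/dx, while
the i-th factor becomes a pure power of x. -/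
theorem factorial_mul_coeff_cofactor_self (hi : D (z i) = 1) (hz : ∀ s, s ≠ i → D (z s) = 0)
    (e k : ℕ) :
    (k.factorial : A) * (cofactor (fun s => z s - z i) e i).coeff (e - 1 + k) =
      D^[k] (∏ s ∈ Finset.univ.erase i, (z i - z s) ^ e) := by
  have hf : coeffDeriv D (∏ s ∈ Finset.univ.erase i, (X - C (z s - z i)) ^ e) =
      derivative (∏ s ∈ Finset.univ.erase i, (X - C (z s - z i)) ^ e) :=
    coeffDeriv_eq_derivative_prod D _ _ fun s hs => coeffDeriv_eq_derivative_pow D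
      (coeffDeriv_X_sub_C_eq_derivative D
        (by rw [map_sub, hi, hz s (Finset.ne_of_mem_erase hs), zero_sub])) _
  have h0 : (∏ s ∈ Finset.univ.erase i, (X - C (z s - z i)) ^ e).coeff 0 =
      ∏ s ∈ Finset.univ.erase i, (z i - z s) ^ e := by
    simp [coeff_zero_eq_eval_zero, eval_prod]
  rw [← h0, ← factorial_mul_coeff D hf, cofactor, sub_self, C_0, sub_zero, add_comm,
    coeff_X_pow_mul]

theorem factorial_mul_coeff_cofactor_of_ne (hi : D (z i) = 1) (hz : ∀ s, s ≠ i → D (z s) = 0)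
    (e k : ℕ) {j : ι} (hij : i ≠ j) :
    (k.factorial : A) * (cofactor (fun s => z s - z i) e j).coeff (e + k) =
      D^[k] (prodDiv (Finset.univ.erase i) (fun s => z i - z s) e j) := by
  have hX : ∀ s, s ≠ i → coeffDeriv D (X - C (z s - z i)) = derivative (X - C (z s - z i)) :=
    fun s hs => coeffDeriv_X_sub_C_eq_derivative D (by rw [map_sub, hi, hz s hs, zero_sub])
  set f : A[X] := (X - C (z j - z i)) ^ (e - 1) *
    ∏ s ∈ (Finset.univ.erase i).erase j, (X - C (z s - z i)) ^ e with hfdef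
  have hf : coeffDeriv D f = derivative f :=
    coeffDeriv_eq_derivative_mul D (coeffDeriv_eq_derivative_pow D (hX j hij.symm) _)
      (coeffDeriv_eq_derivative_prod D _ _ fun s hs => coeffDeriv_eq_derivative_pow D
        (hX s (Finset.ne_of_mem_erase (Finset.mem_of_mem_erase hs))) _)
  have h0 : f.coeff 0 = prodDiv (Finset.univ.erase i) (fun s => z i - z s) e j := by
    simp [hfdef, coeff_zero_eq_eval_zero, eval_prod, prodDiv]
  have hc : cofactor (fun s => z s - z i) e j = X ^ e * f := by
    rw [cofactor_eq_of_ne _ _ hij, sub_self, C_0, sub_zero, hfdef]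
    ring
  rw [← h0, ← factorial_mul_coeff D hf, hc, add_comm e k, coeff_X_pow_mul]

variable {I : ι → A} {h : ℕ}

/-- This is D^k of the KZ equation. At k = h the coefficient h - k vanishes, so D^(h+1) I_j depends
on D^h I_i alone. -/
theorem sub_mul_iterate_derivation {ι : Type*} {z I : ι → A} {i : ι} (hi : D (z i) = 1)
    (hz : ∀ s, s ≠ i → D (z s) = 0)
    (hI : ∀ j, j ≠ i → (z i - z j) * D (I j) = h * (I j - I i)) {j : ι} (hj : j ≠ i) (k : ℕ) :
    (z i - z j) * D^[k + 1] (I j) = (h - k) * D^[k] (I j) - h * D^[k] (I i) := by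
  induction k with
  | zero => simp [hI j hj, mul_sub]
  | succ k ih =>
    have h1 := congrArg D ih
    simp only [map_sub, Derivation.leibniz, hi, hz j hj, Derivation.map_natCast, smul_eq_mul,
      ← Function.iterate_succ_apply' (f := D), Nat.succ_eq_add_one] at h1
    push_cast
    linear_combination h1

theorem iterate_derivation_self_eq (hsum : ∑ j, I j = 0) (k : ℕ) :
    D^[k] (I i) = -∑ j ∈ Finset.univ.erase i, D^[k] (I j) := by
  rw [eq_neg_iff_add_eq_zero, Finset.add_sum_erase _ (fun j => D^[k] (I j)) (Finset.mem_univ i),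
    ← iterate_derivation_sum, hsum, iterate_derivation_zero]

/-- Summing the decoupled equations at k = h over j ≠ i shows that D^h I_i has the same logarithmic
derivative as the product, so their quotient is a constant of D. -/
theorem iterate_derivation_self_eq_const_mul (hi : D (z i) = 1)
    (hz : ∀ s, s ≠ i → D (z s) = 0) (hu : ∀ j, j ≠ i → IsUnit (z i - z j)) (hh : 1 ≤ h)
    (hsum : ∑ j, I j = 0)
    (hI : ∀ j, j ≠ i → (z i - z j) * D (I j) = h * (I j - I i)) :
    ∃ c, D c = 0 ∧ D^[h] (I i) = c * ∏ s ∈ Finset.univ.erase i, (z i - z s) ^ h := by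
  set m := ∏ s ∈ Finset.univ.erase i, (z i - z s) ^ h with hm
  have hDm : D m = h * ∑ j ∈ Finset.univ.erase i,
      prodDiv (Finset.univ.erase i) (fun s => z i - z s) h j :=
    derivation_prod_pow D _ _ (fun s hs => by
      rw [map_sub, hi, hz s (Finset.ne_of_mem_erase hs), sub_zero]) h
  have hPhi : m * D (D^[h] (I i)) = D^[h] (I i) * D m := by
    rw [← Function.iterate_succ_apply' (f := D), iterate_derivation_self_eq D hsum, hDm, mul_neg,
      Finset.mul_sum, Finset.mul_sum, Finset.mul_sum, ← Finset.sum_neg_distrib]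
    refine Finset.sum_congr rfl fun j hj => ?_
    have h1 := sub_mul_iterate_derivation D hi hz hI (Finset.ne_of_mem_erase hj) h
    rw [hm, ← mul_prodDiv _ (fun s => z i - z s) hh hj]
    linear_combination (-prodDiv (Finset.univ.erase i) (fun s => z i - z s) h j) * h1
  have hmu : IsUnit m := by
    rw [hm, IsUnit.prod_iff]
    exact fun s hs => (hu s (Finset.ne_of_mem_erase hs)).pow h
  obtain ⟨v, hv⟩ := hmu.exists_right_inv
  have hDv : m * D v + v * D m = 0 := by
    have := congrArg D hv
    rwa [Derivation.leibniz, Derivation.map_one_eq_zero, smul_eq_mul, smul_eq_mul] at this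
  refine ⟨D^[h] (I i) * v, ?_, by linear_combination -D^[h] (I i) * hv⟩
  rw [Derivation.leibniz, smul_eq_mul, smul_eq_mul]
  linear_combination (D^[h] (I i) * v) * hDv + v ^ 2 * hPhi -
    (D^[h] (I i) * D v + v * D (D^[h] (I i))) * hv

/-- With D^h I_i = c m, where Dc = 0 and m is the product of the (z_i - z_s)^h, the equation D^p I_j
= 0 becomes c times the x^(p-1) coefficient of the j-th translated cofactor, up to a unit. One unit
coefficient forces c = 0. -/
theorem iterate_derivation_self_eq_zero {p : ℕ} [Fact p.Prime] [CharP A p]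
    (hDp : ∀ x, D^[p] x = 0) (hi : D (z i) = 1)
    (hz : ∀ s, s ≠ i → D (z s) = 0) (hu : ∀ j, j ≠ i → IsUnit (z i - z j)) (hh : 1 ≤ h)
    (hhp : h < p) (hsum : ∑ j, I j = 0)
    (hI : ∀ j, j ≠ i → (z i - z j) * D (I j) = h * (I j - I i))
    (hne : ∃ j, IsUnit ((cofactor (fun s => z s - z i) h j).coeff (p - 1))) :
    D^[h] (I i) = 0 := by
  obtain ⟨c, hDc, hc⟩ := iterate_derivation_self_eq_const_mul D hi hz hu hh hsum hI
  obtain ⟨j, hj⟩ := hne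
  suffices hcj : c * (cofactor (fun s => z s - z i) h j).coeff (p - 1) = 0 by
    rw [hc, (hj.mul_left_eq_zero).1 hcj, zero_mul]
  have hfac : ∀ k, k < p → IsUnit (k.factorial : A) := fun k hk =>
    isUnit_natCast_factorial A p hk
  rcases eq_or_ne i j with rfl | hij
  · have h1 := factorial_mul_coeff_cofactor_self D hi hz h (p - h)
    rw [show h - 1 + (p - h) = p - 1 by lia] at h1
    have h2 := hDp (I i)
    rw [show p = (p - h) + h by lia, Function.iterate_add_apply, hc,
      iterate_derivation_const_mul D hDc, ← h1, mul_left_comm] at h2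
    exact (hfac _ (by lia)).mul_right_eq_zero.1 h2
  · have h1 := factorial_mul_coeff_cofactor_of_ne D hi hz h (p - 1 - h) hij
    rw [show h + (p - 1 - h) = p - 1 by lia] at h1
    have h3 : D^[h + 1] (I j) =
        -(h * c) * prodDiv (Finset.univ.erase i) (fun s => z i - z s) h j := by
      refine (hu j hij.symm).mul_left_cancel ?_
      rw [sub_mul_iterate_derivation D hi hz hI hij.symm, hc,
        ← mul_prodDiv _ (fun s => z i - z s) hh (by simp [hij.symm] : j ∈ Finset.univ.erase i)]
      ring
    have h2 := hDp (I j)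
    have hDc' : D (-(h * c) : A) = 0 := by
      rw [map_neg, Derivation.leibniz, hDc, Derivation.map_natCast, smul_zero, smul_zero,
        add_zero, neg_zero]
    rw [show p = (p - 1 - h) + (h + 1) by lia, Function.iterate_add_apply, h3,
      iterate_derivation_const_mul D hDc', ← h1, mul_left_comm, neg_mul, mul_assoc] at h2
    have h4 := neg_eq_zero.1 ((hfac _ (by lia)).mul_right_eq_zero.1 h2)
    refine IsUnit.mul_right_eq_zero ?_ |>.1 h4
    refine isUnit_of_dvd_unit ?_ (hfac h hhp)
    exact_mod_cast Nat.cast_dvd_cast (Nat.dvd_factorial hh le_rfl)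

/-- A descent that moves derivatives one at a time from I to the weight of exponent p - h, which is
-h in A. It starts at D^h I_i = 0 and ends at k = 0, where I is undifferentiated. -/
theorem iterate_pairing_eq_zero {p : ℕ} [CharP A p] (hi : D (z i) = 1)
    (hz : ∀ s, s ≠ i → D (z s) = 0) (hhp : h < p) (hsum : ∑ j, I j = 0)
    (hI : ∀ j, j ≠ i → (z i - z j) * D (I j) = h * (I j - I i)) (h0 : D^[h] (I i) = 0) (κ : ℕ) :
    ∀ k, k + κ = h →
      D^[k] (I i) * D^[κ] (∏ s ∈ Finset.univ.erase i, (z i - z s) ^ (p - h)) +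
        κ * ∑ j ∈ Finset.univ.erase i, D^[k] (I j) *
          D^[κ - 1] (prodDiv (Finset.univ.erase i) (fun s => z i - z s) (p - h) j) = 0 := by
  have hb : ∀ s ∈ Finset.univ.erase i, D (z i - z s) = 1 := fun s hs => by
    rw [map_sub, hi, hz s (Finset.ne_of_mem_erase hs), sub_zero]
  have hg : ((p - h : ℕ) : A) = -h := by
    rw [Nat.cast_sub hhp.le, CharP.cast_eq_zero, zero_sub]
  induction κ with
  | zero =>
    rintro k rfl
    rw [add_zero] at h0
    simp [h0]
  | succ κ ih =>
    intro k hk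
    have h1 := ih (k + 1) (by lia)
    have hκ : (h : A) - k = κ + 1 := by
      rw [← hk]; push_cast; ring
    have hq : D^[κ + 1] (∏ s ∈ Finset.univ.erase i, (z i - z s) ^ (p - h)) =
        -h * ∑ j ∈ Finset.univ.erase i,
          D^[κ] (prodDiv (Finset.univ.erase i) (fun s => z i - z s) (p - h) j) := by
      rw [Function.iterate_succ_apply, derivation_prod_pow D _ _ hb, hg,
        iterate_derivation_const_mul D (by simp), iterate_derivation_sum]
    rw [iterate_derivation_self_eq D hsum, neg_mul, Finset.sum_mul, Finset.mul_sum,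
      ← Finset.sum_neg_distrib, ← Finset.sum_add_distrib] at h1
    rw [hq, Nat.add_sub_cancel, Finset.mul_sum, Finset.mul_sum, Finset.mul_sum,
      ← Finset.sum_add_distrib, ← neg_eq_zero, ← Finset.sum_neg_distrib, ← h1]
    refine Finset.sum_congr rfl fun j hj => ?_
    have h2 := sub_mul_iterate_derivation D hi hz hI (Finset.ne_of_mem_erase hj) k
    rw [← mul_prodDiv _ (fun s => z i - z s) (by lia : 1 ≤ p - h) hj,
      iterate_derivation_mul D (hb j hj)]
    rw [hκ] at h2
    push_cast
    linear_combination
      D^[κ] (prodDiv (Finset.univ.erase i) (fun s => z i - z s) (p - h) j) * h2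

theorem sum_mul_coeff_cofactor_eq_zero {p : ℕ} [Fact p.Prime] [CharP A p] (hi : D (z i) = 1)
    (hz : ∀ s, s ≠ i → D (z s) = 0) (hh : 1 ≤ h) (hhp : h < p) (hsum : ∑ j, I j = 0)
    (hI : ∀ j, j ≠ i → (z i - z j) * D (I j) = h * (I j - I i)) (h0 : D^[h] (I i) = 0) :
    ∑ j, I j * (cofactor (fun s => z s - z i) (p - h) j).coeff (p - 1) = 0 := by
  refine (isUnit_natCast_factorial A p hhp).mul_right_eq_zero.1 ?_
  have h1 := iterate_pairing_eq_zero D hi hz hhp hsum hI h0 h 0 (zero_add h)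
  have hs := factorial_mul_coeff_cofactor_self D hi hz (p - h) h
  rw [show p - h - 1 + h = p - 1 by lia] at hs
  rw [← h1, ← hs, ← Finset.add_sum_erase _ _ (Finset.mem_univ i), mul_add, Finset.mul_sum,
    Finset.mul_sum]
  congr 1
  · simp only [Function.iterate_zero, id_eq]; ring
  · refine Finset.sum_congr rfl fun j hj => ?_
    have hn := factorial_mul_coeff_cofactor_of_ne D hi hz (p - h) (h - 1)
      (Finset.ne_of_mem_erase hj).symm
    rw [show p - h + (h - 1) = p - 1 by lia] at hn
    have hf : (h.factorial : A) = h * ((h - 1).factorial : A) := by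
      rw [← Nat.mul_factorial_pred (by lia)]; push_cast; rfl
    rw [← hn, hf]
    simp only [Function.iterate_zero, id_eq]
    ring

end Curvature

/-! ### From Taylor coefficients at the z_i to coefficients of x^(lp-1) -/

theorem coeff_hasseDeriv_pred {A : Type*} [CommRing A] (p : ℕ) [hp : Fact p.Prime] [CharP A p]
    (F : A[X]) (m : ℕ) :
    (hasseDeriv (p - 1) F).coeff m = if p ∣ m then F.coeff (m + (p - 1)) else 0 := by
  have hp1 := hp.out.one_lt
  have hc := (CharP.natCast_eq_natCast A p).2
    (Choose.choose_modEq_choose_mod_mul_choose_div_nat (p := p) (n := m + (p - 1)) (k := p - 1))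
  rw [Nat.mod_eq_of_lt (by lia : p - 1 < p), Nat.div_eq_of_lt (by lia : p - 1 < p),
    Nat.choose_zero_right, mul_one] at hc
  rw [hasseDeriv_coeff, hc]
  split_ifs with h
  · obtain ⟨k, rfl⟩ := h
    rw [Nat.mul_add_mod, Nat.mod_eq_of_lt (by lia : p - 1 < p), Nat.choose_self, Nat.cast_one,
      one_mul]
  · rw [Nat.choose_eq_zero_of_lt, Nat.cast_zero, zero_mul]
    have h1 : (m + (p - 1)) % p < p := Nat.mod_lt _ (by lia)
    refine lt_of_le_of_ne (by lia) fun h2 => h ?_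
    have h3 := Nat.div_add_mod (m + (p - 1)) p
    rw [h2] at h3
    exact ⟨(m + (p - 1)) / p, by lia⟩

/-- By Lucas, the Hasse derivative of order p - 1 is γ(x^p), where γ collects the coefficients of
index (l+1)p - 1. Its degree is below n and it vanishes at the n distinct points z_i^p. -/
theorem coeff_eq_zero_of_taylor_coeff {A : Type*} [CommRing A] [IsDomain A] (p : ℕ)
    [hp : Fact p.Prime] [CharP A p] {ι : Type*} [Fintype ι] {z : ι → A}
    (hz : Function.Injective z) {F : A[X]} (hF : F.natDegree < Fintype.card ι * p)
    (h : ∀ i, (taylor (z i) F).coeff (p - 1) = 0) (l : ℕ) : F.coeff ((l + 1) * p - 1) = 0 := by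
  have hp0 := hp.out.pos
  set γ := contract p (hasseDeriv (p - 1) F) with hγ
  have hcoeff : ∀ l, γ.coeff l = F.coeff ((l + 1) * p - 1) := fun l => by
    rw [hγ, coeff_contract hp0.ne', coeff_hasseDeriv_pred, if_pos (Nat.dvd_mul_left _ _)]
    congr 1
    rw [add_mul]
    lia
  have hexp : expand A p γ = hasseDeriv (p - 1) F := by
    ext m
    rw [coeff_expand hp0, coeff_hasseDeriv_pred]
    split_ifs with hm
    · obtain ⟨k, rfl⟩ := hm
      rw [Nat.mul_div_cancel_left _ hp0, hcoeff]
      congr 1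
      rw [add_mul, mul_comm p k]
      lia
    · rfl
  have hγ0 : γ = 0 := by
    refine eq_zero_of_degree_lt_of_eval_index_eq_zero (s := Finset.univ)
      (v := fun i => z i ^ p) ?_ ?_ ?_
    · intro i _ j _ hij
      exact hz (frobenius_inj A p hij)
    · rw [degree_lt_iff_coeff_zero]
      intro m hm
      rw [hcoeff]
      refine coeff_eq_zero_of_natDegree_lt (hF.trans_le ?_)
      rw [Finset.card_univ] at hm
      have := Nat.mul_le_mul_right p hm
      rw [add_mul]
      lia
    · intro i _
      rw [← expand_eval, hexp, ← taylor_coeff, h]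
  rw [← hcoeff, hγ0, coeff_zero]

/-! ### Linear algebra over a local ring, from independence of rows over the residue field -/

section LocalLinearAlgebra

variable {R K : Type*} [CommRing R] [Field K] (π : R →+* K) [IsLocalHom π]
  (hπ : Function.Surjective π) {ι m m' : Type*} [Fintype ι] [Fintype m] [DecidableEq m]
  [Fintype m'] [DecidableEq m']

include hπ in
theorem exists_right_inverse_of_linearIndependent {M : Matrix m ι R}
    (hM : LinearIndependent K (M.map π).row) : ∃ N : Matrix ι m R, M * N = 1 := by
  classical
  obtain ⟨g, hg⟩ := (Matrix.toLin' (M.map π)ᵀ).exists_leftInverse_of_injective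
    (LinearMap.ker_eq_bot.2 (Matrix.mulVec_injective_iff.2 hM))
  choose r hr using hπ
  set N₀ : Matrix ι m R := (LinearMap.toMatrix' g)ᵀ.map r with hN₀
  have hN : (M.map π) * (N₀.map π) = 1 := by
    have h1 : N₀.map π = (LinearMap.toMatrix' g)ᵀ := by
      ext i j; simp [hN₀, hr]
    have h2 := congrArg LinearMap.toMatrix' hg
    rw [LinearMap.toMatrix'_comp, LinearMap.toMatrix'_toLin', LinearMap.toMatrix'_id] at h2
    rw [h1, ← Matrix.transpose_one, ← h2, Matrix.transpose_mul, Matrix.transpose_transpose]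
  have hdet : IsUnit (M * N₀).det := by
    refine isUnit_of_map_unit π _ ?_
    rw [RingHom.map_det, RingHom.mapMatrix_apply, Matrix.map_mul, hN, Matrix.det_one]
    exact isUnit_one
  exact ⟨N₀ * (M * N₀)⁻¹, by rw [← Matrix.mul_assoc, Matrix.mul_nonsing_inv _ hdet]⟩

include hπ in
theorem exists_eq_vecMul_of_mulVec_eq_zero {M : Matrix m ι R} {M' : Matrix m' ι R}
    (hM : LinearIndependent K (M.map π).row) (hM' : LinearIndependent K (M'.map π).row)
    (hcard : Fintype.card m + Fintype.card m' = Fintype.card ι) (horth : M' * Mᵀ = 0)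
    {v : ι → R} (hv : M'.mulVec v = 0) : ∃ f : m → R, Matrix.vecMul f M = v := by
  classical
  obtain ⟨N, hN⟩ := exists_right_inverse_of_linearIndependent π hπ hM
  obtain ⟨N', hN'⟩ := exists_right_inverse_of_linearIndependent π hπ hM'
  have hN2 : Nᵀ * Mᵀ = 1 := by rw [← Matrix.transpose_mul, hN, Matrix.transpose_one]
  -- The correction of N' makes the off-diagonal block vanish. The counts agree, so the product in
  -- the other order is also 1; applied to v with M'v = 0 it reads v = Mᵀ(Nᵀv).
  have hcols : Matrix.fromRows Nᵀ M' * Matrix.fromCols (Mᵀ) (N' - Mᵀ * (Nᵀ * N')) = 1 := by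
    rw [Matrix.fromRows_mul_fromCols, Matrix.mul_sub, Matrix.mul_sub, ← Matrix.mul_assoc Nᵀ,
      ← Matrix.mul_assoc M', hN2, horth, hN', Matrix.one_mul, sub_self, Matrix.zero_mul, sub_zero,
      Matrix.fromBlocks_one]
  have hcols' := (Matrix.mul_eq_one_comm_of_card_eq (m ⊕ m') ι R
    (by rw [Fintype.card_sum, hcard])).1 hcols
  refine ⟨Nᵀ.mulVec v, ?_⟩
  have h1 := congrArg (fun T => Matrix.mulVec T v) hcols'
  simp only [← Matrix.mulVec_mulVec, Matrix.one_mulVec, Matrix.fromRows_mulVec, hv] at h1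
  rw [Matrix.fromCols_mulVec] at h1
  simpa [Matrix.mulVec_transpose] using h1

include hπ in
theorem eq_zero_of_vecMul_eq_zero {M : Matrix m ι R} (hM : LinearIndependent K (M.map π).row)
    {f : m → R} (hf : Matrix.vecMul f M = 0) : f = 0 := by
  obtain ⟨N, hN⟩ := exists_right_inverse_of_linearIndependent π hπ hM
  rw [← Matrix.vecMul_one f, ← hN, ← Matrix.vecMul_vecMul, hf, Matrix.zero_vecMul]

end LocalLinearAlgebra

theorem sum_coeff_cofactor {A : Type*} [CommRing A] (p : ℕ) [hp : Fact p.Prime] [CharP A p]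
    {ι : Type*} [Fintype ι] [DecidableEq ι] (z : ι → A) {e : ℕ} (he : 1 ≤ e) (hep : e < p)
    (l : ℕ) : ∑ j, (cofactor z e j).coeff ((l + 1) * p - 1) = 0 := by
  have hu : IsUnit (e : A) :=
    (CharP.isUnit_natCast_iff hp.out).2 (Nat.not_dvd_of_pos_of_lt he hep)
  refine hu.mul_right_eq_zero.1 ?_
  rw [← finsetSum_coeff, ← coeff_C_mul, sum_cofactor z he, coeff_derivative]
  have h1 : (l + 1) * p - 1 + 1 = (l + 1) * p :=
    Nat.sub_add_cancel (Nat.mul_pos l.succ_pos hp.out.pos)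
  have h2 : (((l + 1) * p - 1 : ℕ) : A) + 1 = 0 := by
    rw [← Nat.cast_add_one, h1, Nat.cast_mul, CharP.cast_eq_zero A p, mul_zero]
  rw [h2, mul_zero]

/-! ### Formal power series and the flatness equations -/

section Formal

variable {K : Type*} [Field K] {n : ℕ}

theorem isUnit_coord_sub {a : Fin n → K} (ha : Function.Injective a) {i j : Fin n} (hij : i ≠ j) :
    IsUnit (coord a i - coord a j) := by
  rw [MvPowerSeries.isUnit_iff_constantCoeff]
  simpa [coord, sub_eq_zero] using fun h => hij (ha h)

theorem constantCoeff_coord (a : Fin n → K) (i : Fin n) :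
    MvPowerSeries.constantCoeff (coord a i) = a i := by
  simp [coord]

theorem coord_injective {a : Fin n → K} (ha : Function.Injective a) :
    Function.Injective (coord a) := fun i j h => ha <| by
  rw [← constantCoeff_coord a i, h, constantCoeff_coord]

theorem pderiv_coord_self (a : Fin n → K) (i : Fin n) :
    MvPowerSeries.pderiv K i (coord a i) = 1 := by
  simp [coord, MvPowerSeries.pderiv_C]

theorem pderiv_coord_of_ne (a : Fin n → K) {i s : Fin n} (h : s ≠ i) :
    MvPowerSeries.pderiv K i (coord a s) = 0 := by
  simp [coord, MvPowerSeries.pderiv_C, h]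

theorem coeff_iterate_pderiv (i : Fin n) (f : MvPowerSeries (Fin n) K) (k : ℕ) (m : Fin n →₀ ℕ) :
    MvPowerSeries.coeff m ((MvPowerSeries.pderiv K i)^[k] f) =
      MvPowerSeries.coeff (m + Finsupp.single i k) f * ((m i + 1).ascFactorial k : ℕ) := by
  induction k generalizing m with
  | zero => simp
  | succ k ih =>
    rw [Function.iterate_succ_apply', MvPowerSeries.coeff_pderiv, ih, add_assoc,
      ← Finsupp.single_add, add_comm 1 k, Nat.ascFactorial_succ, ← Nat.succ_ascFactorial,
      Finsupp.add_apply, Finsupp.single_eq_same, mul_assoc]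
    push_cast
    ring

theorem iterate_pderiv_eq_zero (p : ℕ) [hp : Fact p.Prime] [CharP K p] (i : Fin n)
    (f : MvPowerSeries (Fin n) K) : (MvPowerSeries.pderiv K i)^[p] f = 0 := by
  ext m
  rw [coeff_iterate_pderiv, (CharP.cast_eq_zero_iff K p _).2, mul_zero, map_zero]
  exact (Nat.dvd_factorial hp.out.pos le_rfl).trans (Nat.factorial_dvd_ascFactorial _ _)

theorem mem_pthPowerSeries_of_pderiv_eq_zero (p : ℕ) [hp : Fact p.Prime] [CharP K p]
    {f : MvPowerSeries (Fin n) K} (hf : ∀ i, MvPowerSeries.pderiv K i f = 0) :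
    f ∈ pthPowerSeries K n p := by
  have h0 : ∀ m : Fin n →₀ ℕ, ∀ i, ¬ p ∣ m i → MvPowerSeries.coeff m f = 0 := fun m i hm => by
    have hmi : m i ≠ 0 := fun h => hm (h ▸ dvd_zero p)
    have h1 := congrArg (MvPowerSeries.coeff (m - Finsupp.single i 1)) (hf i)
    have h2 : m - Finsupp.single i 1 + Finsupp.single i 1 = m :=
      tsub_add_cancel_of_le (Finsupp.single_le_iff.2 (Nat.one_le_iff_ne_zero.2 hmi))
    rw [MvPowerSeries.coeff_pderiv, h2, map_zero] at h1
    refine (mul_eq_zero.1 h1).resolve_right ?_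
    rw [Finsupp.tsub_apply, Finsupp.single_eq_same, ← Nat.cast_add_one,
      Nat.sub_add_cancel (Nat.one_le_iff_ne_zero.2 hmi)]
    exact fun h => hm ((CharP.cast_eq_zero_iff K p _).1 h)
  obtain ⟨g, hg⟩ : ∃ g : MvPowerSeries (Fin n) K,
      ∀ m, MvPowerSeries.coeff m g = MvPowerSeries.coeff (p • m) f := ⟨_, fun _ => rfl⟩
  refine ⟨g, ?_⟩
  ext m
  by_cases hm : ∀ i, p ∣ m i
  · choose r hr using hm
    have hmr : m = p • Finsupp.equivFunOnFinite.symm r := by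
      ext i; simp [hr]
    simp only [AlgHom.toRingHom_eq_coe, RingHom.coe_coe]
    rw [hmr, MvPowerSeries.coeff_expand_smul, hg]
  · push Not at hm
    obtain ⟨i, hi⟩ := hm
    simp only [AlgHom.toRingHom_eq_coe, RingHom.coe_coe]
    rw [h0 m i hi, MvPowerSeries.coeff_expand_of_not_dvd p hp.out.ne_zero _ hi]

theorem nabla_apply_of_ne (a : Fin n → K) (h : K) {i j : Fin n} (hij : j ≠ i)
    (I : Fin n → MvPowerSeries (Fin n) K) :
    nabla a h i I j = MvPowerSeries.pderiv K i (I j) +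
      h • ((coord a i - coord a j)⁻¹ * (I i - I j)) := by
  have : (gaudin a i *ᵥ I) j = (coord a i - coord a j)⁻¹ * (I i - I j) := by
    rw [gaudin, Matrix.sum_mulVec, Finset.sum_apply, Finset.sum_eq_single j]
    · simp [Omega, Matrix.smul_mulVec, Matrix.add_mulVec, Matrix.sub_mulVec,
        Matrix.single_mulVec_eq, hij]
    · intro s _ hsj
      simp [Omega, Matrix.smul_mulVec, Matrix.add_mulVec, Matrix.sub_mulVec,
        Matrix.single_mulVec_eq, hij, hsj.symm]
    · simp [hij]
  simp [nabla, this]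

theorem sum_nabla (a : Fin n → K) (h : K) (i : Fin n) (I : Fin n → MvPowerSeries (Fin n) K) :
    ∑ j, nabla a h i I j = MvPowerSeries.pderiv K i (∑ j, I j) := by
  have : ∑ j, (gaudin a i *ᵥ I) j = 0 := by
    simp only [gaudin, Matrix.sum_mulVec, Finset.sum_apply]
    rw [Finset.sum_comm]
    refine Finset.sum_eq_zero fun s _ => ?_
    simp [Omega, Matrix.smul_mulVec, Matrix.add_mulVec, Matrix.sub_mulVec,
        Matrix.single_mulVec_eq, ← Finset.mul_sum, Finset.sum_add_distrib, Finset.sum_sub_distrib]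
  simp [nabla, Finset.sum_add_distrib, ← Finset.smul_sum, this]

theorem mem_flatSections_iff {p : ℕ} [Fact p.Prime] [CharP K p] {a : Fin n → K}
    (ha : Function.Injective a) (e : ℕ) (I : Fin n → MvPowerSeries (Fin n) K) :
    I ∈ flatSections p a (e : K) ↔ ∑ j, I j = 0 ∧ ∀ i j, j ≠ i →
      (coord a i - coord a j) * MvPowerSeries.pderiv K i (I j) = e * (I j - I i) := by
  have key : ∀ i j, j ≠ i → (nabla a (e : K) i I j = 0 ↔
      (coord a i - coord a j) * MvPowerSeries.pderiv K i (I j) = e * (I j - I i)) := by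
    intro i j hij
    have hu := isUnit_coord_sub ha hij.symm
    have hinv : (coord a i - coord a j) * (coord a i - coord a j)⁻¹ = 1 :=
      MvPowerSeries.mul_inv_cancel _ ((MvPowerSeries.isUnit_iff_constantCoeff.1 hu).ne_zero)
    rw [nabla_apply_of_ne a _ hij, ← hu.mul_right_eq_zero, Nat.cast_smul_eq_nsmul, nsmul_eq_mul,
      ← sub_eq_zero (b := _ * (_ - _))]
    refine Eq.congr_left ?_
    linear_combination (e * (I i - I j)) * hinv
  refine and_congr_right fun hsum => ⟨fun h i j hij => (key i j hij).1 (congrFun (h i) j),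
    fun h i => ?_⟩
  have h1 : ∀ j, j ≠ i → nabla a (e : K) i I j = 0 := fun j hij => (key i j hij).2 (h i j hij)
  have h2 := sum_nabla a (e : K) i I
  rw [hsum, map_zero, Finset.sum_eq_single i (fun j _ hij => h1 j hij) (by simp)] at h2
  ext1 j
  by_cases hij : j = i
  · rw [hij, h2, Pi.zero_apply]
  · exact h1 j hij

end Formal

theorem linearIndependent_cofactor {K : Type*} [Field K] {ι : Type*} [Fintype ι] [DecidableEq ι]
    {a : ι → K} (ha : Function.Injective a) (p : ℕ) [Fact p.Prime] [CharP K p] {e d : ℕ}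
    (he : 1 ≤ e) (hep : e < p) (hd : d * p ≤ Fintype.card ι * e) :
    LinearIndependent K fun (l : Fin d) (j : ι) => (cofactor a e j).coeff ((l.val + 1) * p - 1) := by
  rw [Fintype.linearIndependent_iff]
  intro g hg l
  have h := cofactor_coeff_independent ha p he hep hd
    (fun l => if hl : l < d then g ⟨l, hl⟩ else 0) (fun j => by
      rw [Finset.sum_range]
      simpa using congrFun hg j) l l.2
  simpa using h

/-- The fractions ne/p and n(p-e)/p add up to n and are not integers, so their integer parts add up
to n - 1. -/
theorem div_add_div_add_one {p n e : ℕ} (hp : p.Prime) (he : 1 ≤ e) (hep : e < p)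
    (hpn : ¬ p ∣ n) : n * e / p + (n * (p - e) / p + 1) = n := by
  have hr : n * e % p ≠ 0 := fun h => by
    rcases hp.dvd_mul.1 (Nat.dvd_of_mod_eq_zero h) with h | h
    · exact hpn h
    · exact Nat.not_dvd_of_pos_of_lt he hep h
  have h1 := Nat.div_add_mod (n * e) p
  have h2 : (n * e % p) < p := Nat.mod_lt _ hp.pos
  have h3 : n * e + n * (p - e) = n * p := by rw [← mul_add]; congr 1; lia
  have h4 : n * e / p < n := by
    rw [Nat.div_lt_iff_lt_mul hp.pos]
    exact Nat.mul_lt_mul_of_pos_left hep (Nat.pos_of_ne_zero fun h => hpn (h ▸ dvd_zero p))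
  generalize n * e / p = d at *
  obtain ⟨k, hk⟩ := Nat.exists_eq_add_of_lt h4
  have h5 : n * (p - e) / p = k := by
    have h6 : n * p = p * d + k * p + p := by rw [hk]; ring
    rw [Nat.div_eq_iff hp.pos]
    constructor <;> lia
  lia

/-! ### Solution matrices, orthogonality and the basis -/

section Formal

variable {K : Type*} [Field K] {n : ℕ}

instance : IsLocalHom (MvPowerSeries.constantCoeff (σ := Fin n) (R := K)) :=
  ⟨fun _ h => MvPowerSeries.isUnit_iff_constantCoeff.2 h⟩

theorem constantCoeff_surjective :
    Function.Surjective (MvPowerSeries.constantCoeff (σ := Fin n) (R := K)) :=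
  fun x => ⟨MvPowerSeries.C x, MvPowerSeries.constantCoeff_C x⟩

theorem constantCoeff_coeff_cofactor (z : Fin n → MvPowerSeries (Fin n) K) (e k : ℕ) (j : Fin n) :
    MvPowerSeries.constantCoeff ((cofactor z e j).coeff k) =
      (cofactor (fun s => MvPowerSeries.constantCoeff (z s)) e j).coeff k := by
  rw [← map_cofactor, coeff_map]

theorem charP_mvPowerSeries (p : ℕ) [CharP K p] : CharP (MvPowerSeries (Fin n) K) p :=
  charP_of_injective_ringHom (f := MvPowerSeries.C) MvPowerSeries.C_injective p

/-- The matrix whose rows are the `p`-hypergeometric solutions. -/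
def solutionMatrix (p : ℕ) (a : Fin n → K) (e d : ℕ) :
    Matrix (Fin d) (Fin n) (MvPowerSeries (Fin n) K) :=
  Matrix.of fun l j => (cofactor (coord a) e j).coeff ((l.val + 1) * p - 1)

/-- The solution matrix with an additional row of ones. -/
def extendedSolutionMatrix (p : ℕ) (a : Fin n → K) (e d : ℕ) :
    Matrix (Option (Fin d)) (Fin n) (MvPowerSeries (Fin n) K) :=
  Matrix.of fun o j => o.elim 1 fun l => solutionMatrix p a e d l j

theorem constantCoeff_solutionMatrix (p : ℕ) (a : Fin n → K) (e d : ℕ) (l : Fin d) (j : Fin n) :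
    MvPowerSeries.constantCoeff (solutionMatrix p a e d l j) =
      (cofactor a e j).coeff ((l.val + 1) * p - 1) := by
  simp only [solutionMatrix, Matrix.of_apply, constantCoeff_coeff_cofactor, constantCoeff_coord]

variable (p : ℕ) [hp : Fact p.Prime] [CharP K p]

theorem linearIndependent_solutionMatrix {a : Fin n → K} (ha : Function.Injective a) {e d : ℕ}
    (he : 1 ≤ e) (hep : e < p) (hd : d * p ≤ n * e) :
    LinearIndependent K ((solutionMatrix p a e d).map MvPowerSeries.constantCoeff).row := by
  have h : ((solutionMatrix p a e d).map MvPowerSeries.constantCoeff).row = fun l j =>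
      (cofactor a e j).coeff ((l.val + 1) * p - 1) :=
    funext fun l => funext fun j => constantCoeff_solutionMatrix p a e d l j
  rw [h]
  exact linearIndependent_cofactor ha p he hep (by rwa [Fintype.card_fin])

/-- Summing the components of a relation kills the solution rows and leaves n times the coefficient
of the row of ones; n is nonzero in K. -/
theorem linearIndependent_extendedSolutionMatrix {a : Fin n → K} (ha : Function.Injective a)
    {e d : ℕ} (he : 1 ≤ e) (hep : e < p) (hd : d * p ≤ n * e) (hpn : ¬ p ∣ n) :
    LinearIndependent K
      ((extendedSolutionMatrix p a e d).map MvPowerSeries.constantCoeff).row := by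
  have hind := linearIndependent_cofactor ha p he hep (d := d) (by rwa [Fintype.card_fin])
  rw [Fintype.linearIndependent_iff] at hind ⊢
  intro g hg
  have hg' : ∀ j, g none + ∑ l : Fin d, g (some l) *
      (cofactor a e j).coeff ((l.val + 1) * p - 1) = 0 := fun j => by
    have h1 := congrFun hg j
    simpa [Fintype.sum_option, extendedSolutionMatrix, Matrix.row,
      constantCoeff_solutionMatrix] using h1
  have h0 : g none = 0 := by
    have h1 := Finset.sum_congr (rfl : Finset.univ = Finset.univ) fun j _ => hg' j
    rw [Finset.sum_add_distrib, Finset.sum_comm] at h1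
    simp only [← Finset.mul_sum, sum_coeff_cofactor p a he hep, mul_zero, Finset.sum_const_zero,
      add_zero, Finset.sum_const, Finset.card_univ, Fintype.card_fin, nsmul_eq_mul] at h1
    exact (mul_eq_zero.1 h1).resolve_left fun h => hpn ((CharP.cast_eq_zero_iff K p n).1 h)
  have h1 := hind (fun l => g (some l)) (by
    ext j
    simpa [h0] using hg' j)
  rintro (_ | l)
  · exact h0
  · exact h1 l

variable {a : Fin n → K} (ha : Function.Injective a) {e : ℕ} (he : 1 ≤ e) (hep : e < p)

include ha he hep

theorem coeff_cofactor_mem_flatSections (l : ℕ) :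
    (fun j => (cofactor (coord a) e j).coeff ((l + 1) * p - 1)) ∈ flatSections p a (e : K) := by
  have := charP_mvPowerSeries (K := K) (n := n) p
  rw [mem_flatSections_iff ha]
  refine ⟨sum_coeff_cofactor p _ he hep l, fun i j hij => ?_⟩
  have h := coeffDeriv_cofactor (MvPowerSeries.pderiv K i) hij.symm (pderiv_coord_self a i)
    (fun s hs => pderiv_coord_of_ne a hs) he
  have h1 := congrArg (fun f => coeff f ((l + 1) * p - 1)) h
  simpa only [coeff_C_mul, coeff_coeffDeriv, coeff_sub] using h1

/-- Flat sections for `h` are orthogonal to the `p`-hypergeometric solutions for `-h`. -/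
theorem sum_mul_coeff_cofactor_eq_zero_of_mem (hpe : p ≤ n * e)
    {I : Fin n → MvPowerSeries (Fin n) K}
    (hI : I ∈ flatSections p a (e : K)) (l : ℕ) :
    ∑ j, I j * (cofactor (coord a) (p - e) j).coeff ((l + 1) * p - 1) = 0 := by
  have := charP_mvPowerSeries (K := K) (n := n) p
  have : IsDomain (MvPowerSeries (Fin n) K) := NoZeroDivisors.to_isDomain _
  have hp0 := hp.out.pos
  rw [mem_flatSections_iff ha] at hI
  obtain ⟨hsum, hI⟩ := hI
  have hn : 0 < n := Nat.pos_of_ne_zero fun h => by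
    rw [h, zero_mul] at hpe
    lia
  have h1 : ∀ i, (MvPowerSeries.pderiv K i)^[e] (I i) = 0 := by
    intro i
    refine iterate_derivation_self_eq_zero (MvPowerSeries.pderiv K i) (z := coord a)
      (iterate_pderiv_eq_zero p i) (pderiv_coord_self a i) (fun s hs => pderiv_coord_of_ne a hs)
      (fun j hj => isUnit_coord_sub ha hj.symm) he hep hsum (hI i) ?_
    -- Independence at the translated points a_s - a_i with d = 1, available because p ≤ ne, makes
    -- some x^(p-1) coefficient nonzero at a, hence a unit.
    by_contra! hne
    refine one_ne_zero (α := K) (cofactor_coeff_independent (a := fun s => a s - a i) (d := 1)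
      (fun s t hst => ha (sub_left_injective hst)) p he hep
      (by simpa using hpe) (fun _ => 1) (fun j => ?_) 0 zero_lt_one)
    have h2 := hne j
    rw [MvPowerSeries.isUnit_iff_constantCoeff, isUnit_iff_ne_zero, not_not,
      constantCoeff_coeff_cofactor] at h2
    simpa [constantCoeff_coord] using h2
  have h3 : ∀ k, (∑ j, C (I j) * cofactor (coord a) (p - e) j).coeff k =
      ∑ j, I j * (cofactor (coord a) (p - e) j).coeff k := fun k => by
    simp only [finsetSum_coeff, coeff_C_mul]
  rw [← h3]
  refine coeff_eq_zero_of_taylor_coeff p (coord_injective ha) ?_ (fun i => ?_) l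
  · refine lt_of_le_of_lt (b := n * p - 1) (natDegree_sum_le_of_forall_le _ _ fun j _ => ?_) ?_
    · refine (natDegree_C_mul_le _ _).trans ?_
      have h4 := natDegree_cofactor_lt (coord a) (by lia : 1 ≤ p - e) j
      rw [Fintype.card_fin] at h4
      have h5 := Nat.mul_le_mul_left n (Nat.sub_le p e)
      lia
    · rw [Fintype.card_fin]
      have := Nat.mul_pos hn hp0
      lia
  · rw [map_sum, finsetSum_coeff]
    simp only [taylor_mul, taylor_C, taylor_cofactor, coeff_C_mul]
    exact sum_mul_coeff_cofactor_eq_zero (MvPowerSeries.pderiv K i) (pderiv_coord_self a i)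
      (fun s hs => pderiv_coord_of_ne a hs) he hep hsum (hI i) (h1 i)

theorem extendedSolutionMatrix_mulVec_eq_zero (hpe : p ≤ n * e) (d : ℕ)
    {I : Fin n → MvPowerSeries (Fin n) K} (hI : I ∈ flatSections p a (e : K)) :
    (extendedSolutionMatrix p a (p - e) d).mulVec I = 0 := by
  ext1 o
  rcases o with _ | l
  · simpa [extendedSolutionMatrix, Matrix.mulVec, dotProduct] using hI.1
  · refine Eq.trans ?_ (sum_mul_coeff_cofactor_eq_zero_of_mem p ha he hep hpe hI l)
    rw [Matrix.mulVec, dotProduct]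
    exact Finset.sum_congr rfl fun j _ => mul_comm _ _

theorem exists_vecMul_eq_of_mem_flatSections (hpn : ¬ p ∣ n) (hpe : p ≤ n * e)
    {I : Fin n → MvPowerSeries (Fin n) K} (hI : I ∈ flatSections p a (e : K)) :
    ∃ f : Fin (n * e / p) → MvPowerSeries (Fin n) K,
      ∀ j, ∑ l, f l * (cofactor (coord a) e j).coeff ((l.val + 1) * p - 1) = I j := by
  have hcard : Fintype.card (Fin (n * e / p)) + Fintype.card (Option (Fin (n * (p - e) / p))) =
      Fintype.card (Fin n) := by
    rw [Fintype.card_option, Fintype.card_fin, Fintype.card_fin, Fintype.card_fin]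
    exact div_add_div_add_one hp.out he hep hpn
  have hM := linearIndependent_solutionMatrix p ha he hep (Nat.div_mul_le_self (n * e) p)
  have hM' := linearIndependent_extendedSolutionMatrix p ha (e := p - e) (by lia) (by lia)
    (Nat.div_mul_le_self (n * (p - e)) p) hpn
  have horth : extendedSolutionMatrix p a (p - e) (n * (p - e) / p) *
      (solutionMatrix p a e (n * e / p))ᵀ = 0 := by
    ext1 o l
    exact congrFun (extendedSolutionMatrix_mulVec_eq_zero p ha he hep hpe _
      (coeff_cofactor_mem_flatSections p ha he hep l)) o
  obtain ⟨f, hf⟩ := exists_eq_vecMul_of_mulVec_eq_zero _ constantCoeff_surjective hM hM' hcard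
    horth (extendedSolutionMatrix_mulVec_eq_zero p ha he hep hpe _ hI)
  exact ⟨f, fun j => congrFun hf j⟩

theorem eq_zero_of_sum_mul_coeff_cofactor {f : Fin (n * e / p) → MvPowerSeries (Fin n) K}
    (hf : ∀ j, ∑ l, f l * (cofactor (coord a) e j).coeff ((l.val + 1) * p - 1) = 0) : f = 0 := by
  have hM := linearIndependent_solutionMatrix p ha he hep (Nat.div_mul_le_self (n * e) p)
  exact eq_zero_of_vecMul_eq_zero _ constantCoeff_surjective hM (funext hf)

theorem exists_basis_flatSections (hpn : ¬ p ∣ n) (hpe : p ≤ n * e) :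
    ∃ b : Module.Basis (Fin (n * e / p)) (pthPowerSeries K n p) (flatSections p a (e : K)),
      ∀ l, (b l : Fin n → MvPowerSeries (Fin n) K) =
        fun j => (cofactor (coord a) e j).coeff ((l.val + 1) * p - 1) := by
  let v : Fin (n * e / p) → flatSections p a (e : K) := fun l =>
    ⟨_, coeff_cofactor_mem_flatSections p ha he hep l⟩
  have hv : ∀ (c : Fin (n * e / p) → pthPowerSeries K n p) j,
      ((∑ l, c l • v l : flatSections p a (e : K)) : Fin n → MvPowerSeries (Fin n) K) j =
        ∑ l, (c l : MvPowerSeries (Fin n) K) *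
          (cofactor (coord a) e j).coeff ((l.val + 1) * p - 1) := fun c j => by
    simp [v, Subalgebra.smul_def]
  have hli : LinearIndependent (pthPowerSeries K n p) v := by
    have hiff := Fintype.linearIndependent_iff (R := pthPowerSeries K n p) (v := v)
    refine hiff.2 fun c hc l => ?_
    have h1 := eq_zero_of_sum_mul_coeff_cofactor p ha he hep
      (f := fun l => (c l : MvPowerSeries (Fin n) K)) fun j => by rw [← hv, hc]; rfl
    exact Subtype.ext (congrFun h1 l)
  have hsp : ⊤ ≤ Submodule.span (pthPowerSeries K n p) (Set.range v) := by
    rintro ⟨I, hI⟩ -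
    obtain ⟨f, hf⟩ := exists_vecMul_eq_of_mem_flatSections p ha he hep hpn hpe hI
    have hfmem : ∀ l, f l ∈ pthPowerSeries K n p := by
      refine fun l => mem_pthPowerSeries_of_pderiv_eq_zero p fun i => ?_
      have hI' := ((mem_flatSections_iff ha e I).1 hI).2 i
      have hQ : ∀ l : Fin (n * e / p), _ := fun l =>
        ((mem_flatSections_iff ha e _).1 (coeff_cofactor_mem_flatSections p ha he hep l)).2 i
      -- I and the solutions obey the same linear equations, so by Leibniz only the terms with ∂_i
      -- f_l survive. The component j = i is then recovered from the zero sum.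
      have h1 : ∀ j, j ≠ i → ∑ l, MvPowerSeries.pderiv K i (f l) *
          (cofactor (coord a) e j).coeff ((l.val + 1) * p - 1) = 0 := by
        intro j hij
        refine (isUnit_coord_sub ha hij.symm).mul_right_eq_zero.1 ?_
        have h2 := hI' j hij
        rw [← hf j, ← hf i, map_sum, Finset.mul_sum, ← Finset.sum_sub_distrib,
          Finset.mul_sum] at h2
        rw [Finset.mul_sum, ← sub_eq_zero.2 h2, ← Finset.sum_sub_distrib]
        refine Finset.sum_congr rfl fun l _ => ?_
        have h3 := hQ l j hij
        rw [Derivation.leibniz, smul_eq_mul, smul_eq_mul]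
        linear_combination (-f l) * h3
      have h2 : ∑ l, MvPowerSeries.pderiv K i (f l) *
          (cofactor (coord a) e i).coeff ((l.val + 1) * p - 1) = 0 := by
        have h3 : ∑ j, ∑ l, MvPowerSeries.pderiv K i (f l) *
            (cofactor (coord a) e j).coeff ((l.val + 1) * p - 1) = 0 := by
          rw [Finset.sum_comm]
          refine Finset.sum_eq_zero fun l _ => ?_
          rw [← Finset.mul_sum, (coeff_cofactor_mem_flatSections p ha he hep l).1, mul_zero]
        rwa [Finset.sum_eq_single i (fun j _ hij => h1 j hij) (by simp)] at h3
      exact congrFun (eq_zero_of_sum_mul_coeff_cofactor p ha he hep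
        (f := fun l => MvPowerSeries.pderiv K i (f l)) fun j => by
          by_cases hij : j = i
          · rw [hij, h2]
          · exact h1 j hij) l
    have h1 : (⟨I, hI⟩ : flatSections p a (e : K)) =
        ∑ l, (⟨f l, hfmem l⟩ : pthPowerSeries K n p) • v l :=
      Subtype.ext (funext fun j => by rw [hv]; exact (hf j).symm)
    rw [h1]
    exact Submodule.sum_mem _ fun l _ => Submodule.smul_mem _ _ (Submodule.subset_span ⟨l, rfl⟩)
  exact ⟨Module.Basis.mk hli hsp, fun l => by rw [Module.Basis.mk_apply]⟩

end Formal

theorem hyperQFormal_eq_coeff_cofactor {p n : ℕ} {K : Type*} [Field K] [Algebra (ZMod p) K]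
    (a : Fin n → K) {h : ZMod p} (hh : 1 ≤ h.val) (k : ℕ) :
    hyperQFormal a h k = fun j => (cofactor (coord a) h.val j).coeff k := by
  ext1 j
  have h1 : (cofactor (coord a) h.val j) = (cofactor (MvPolynomial.X : Fin n →
      MvPolynomial (Fin n) (ZMod p)) h.val j).map (MvPolynomial.aeval (coord a)).toRingHom := by
    rw [map_cofactor]
    simp
  rw [h1, coeff_map, ← divByMonic_eq_cofactor _ hh]
  rfl

end KZ

end

theorem mainTheorem8 (p n : ℕ) [Fact p.Prime] (hpn : ¬ p ∣ n) (h : ZMod p) (hh : h ≠ 0)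
    (hpos : 0 < n * h.val / p) (a : Fin n → AlgebraicClosure (ZMod p))
    (ha : Function.Injective a) :
    Module.Free (KZ.pthPowerSeries (AlgebraicClosure (ZMod p)) n p)
      (KZ.flatSections p a (algebraMap (ZMod p) (AlgebraicClosure (ZMod p)) h)) ∧
    Module.finrank (KZ.pthPowerSeries (AlgebraicClosure (ZMod p)) n p)
      (KZ.flatSections p a (algebraMap (ZMod p) (AlgebraicClosure (ZMod p)) h)) =
        n * h.val / p ∧
    ∃ b : Module.Basis (Fin (n * h.val / p))
        (KZ.pthPowerSeries (AlgebraicClosure (ZMod p)) n p)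
        (KZ.flatSections p a (algebraMap (ZMod p) (AlgebraicClosure (ZMod p)) h)),
      ∀ l : Fin (n * h.val / p),
        (b l : Fin n → MvPowerSeries (Fin n) (AlgebraicClosure (ZMod p))) =
          KZ.hyperQFormal a h ((l.val + 1) * p - 1) := by
  have he : 1 ≤ h.val := Nat.one_le_iff_ne_zero.2 ((ZMod.val_ne_zero h).2 hh)
  have hcast : algebraMap (ZMod p) (AlgebraicClosure (ZMod p)) h = (h.val : AlgebraicClosure _) := by
    rw [← map_natCast (algebraMap (ZMod p) (AlgebraicClosure (ZMod p))), ZMod.natCast_zmod_val]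
  have hpe : p ≤ n * h.val := (Nat.div_pos_iff.1 hpos).2
  rw [hcast]
  obtain ⟨b, hb⟩ := KZ.exists_basis_flatSections p ha he (ZMod.val_lt h) hpn hpe
  refine ⟨Module.Free.of_basis b, ?_, b, fun l => ?_⟩
  · rw [Module.finrank_eq_card_basis b, Fintype.card_fin]
  · rw [hb, KZ.hyperQFormal_eq_coeff_cofactor a he]
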